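/- Let $\mathbb{B}$ be a complete Boolean algebra, with joins written $\sum$, meets written $\prod$, and each ordinal identified with the set of smaller ordinals. For ordinals $\lambda,\kappa$, say that $\mathbb{B}$ is *$(\lambda,\kappa)$-distributive* if $$\prod_{\alpha<\lambda}\sum_{\beta<\kappa}u_{\alpha,\beta}=\sum_{f:\lambda\to\kappa}\ \prod_{\alpha<\lambda}u_{\alpha,f(\alpha)}$$ for every family $\langle u_{\alpha,\beta}\in\mathbb{B}:\alpha<\lambda,\ \beta<\kappa\rangle$, and that $\mathbb{B}$ is *weakly $(\lambda,\kappa)$-distributive* if $$\prod_{\alpha<\lambda}\sum_{\beta<\kappa}u_{\alpha,\beta}=\sum_{g:\lambda\to\kappa}\ \prod_{\alpha<\lambda}\ \sum_{\beta<g(\alpha)}u_{\alpha,\beta}$$ for every such family. **Theorem (A).** Let $\mathbb{B}$ be a complete Boolean algebra and let $\lambda$ be an infinite cardinal. If $\mathbb{B}$ is weakly $(\lambda^{\omega},\omega)$-distributive, where $\lambda^{\omega}$ is the cardinal power (the cardinality of the set of functions from $\omega$ to $\lambda$), then $\mathbb{B}$ is $(\lambda,2)$-distributive. -/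

import Mathlib

universe u v
open Cardinal Ordinal

/-- A complete Boolean algebra `B` is `(l, k)`-distributive, for ordinals `l` and `k`, if for every
family `u` in `B` indexed by pairs `(a, b)` with `a < l` and `b < k`,
`∏_{a < l} ∑_{b < k} u a b = ∑_{f : l → k} ∏_{a < l} u a (f a)`.
An ordinal is identified with the set of smaller ordinals. -/
def IsDistributiveBA (B : Type u) [CompleteBooleanAlgebra B] (l k : Ordinal.{v}) : Prop :=
  ∀ u : Set.Iio l → Set.Iio k → B,
    (⨅ a, ⨆ b, u a b) = ⨆ f : Set.Iio l → Set.Iio k, ⨅ a, u a (f a)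

/-- A complete Boolean algebra `B` is weakly `(l, k)`-distributive, for ordinals `l` and `k`, if for
every family `u` in `B` indexed by pairs `(a, b)` with `a < l` and `b < k`,
`∏_{a < l} ∑_{b < k} u a b = ∑_{g : l → k} ∏_{a < l} ∑_{b < g a} u a b`. -/
def IsWeaklyDistributiveBA (B : Type u) [CompleteBooleanAlgebra B] (l k : Ordinal.{v}) : Prop :=
  ∀ u : Set.Iio l → Set.Iio k → B,
    (⨅ a, ⨆ b, u a b) =
      ⨆ g : Set.Iio l → Set.Iio k, ⨅ a, ⨆ b : Set.Iio k, ⨆ _ : b < g a, u a b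

/-! For each sequence `x` of indices, the elements `(a (x n))ᶜ ⊔ ⨅ m, a (x m)` join to `⊤`; there
are `λ^ω` such sequences. Weak distributivity yields, densely, a `b` and a bound `g` such that below
`b`, if `a (x m)` holds for all `m < g x`, it holds for all `m`. If nothing nonzero below `b`
decided every `a i`, a descending chain of undecided choices would violate this at stage `g x`. -/

theorem inf_compl_eq_bot_iff_le {B : Type*} [BooleanAlgebra B] {x y : B} : x ⊓ yᶜ = ⊥ ↔ x ≤ y := by
  rw [← disjoint_iff, disjoint_compl_right_iff]

/-- If every nonzero element below `b` fails to decide some `a i`, then weak distributivity over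
sequences in `I` fails below `b`: for any bound `g`, some sequence `x` of undecided points has
`b` not below `⨆ m < g x, (a (x m))ᶜ ⊔ ⨅ n, a (x n)`. -/
theorem exists_seq_not_le {B : Type*} [CompleteBooleanAlgebra B] {I : Type*} (a : I → B)
    (g : (ℕ → I) → ℕ) {b : B} (hb : b ≠ ⊥)
    (hund : ∀ d ≤ b, d ≠ ⊥ → ∃ i, d ⊓ a i ≠ ⊥ ∧ d ⊓ (a i)ᶜ ≠ ⊥) :
    ∃ x : ℕ → I, ¬ b ≤ ⨆ m, ⨆ _ : m < g x, (a (x m))ᶜ ⊔ ⨅ n, a (x n) := by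
  have : Nonempty I := (hund b le_rfl hb).nonempty
  choose! p hp using hund
  let s : ℕ → B := fun n => Nat.rec b (fun _ d => d ⊓ a (p d)) n
  have hs_succ (n : ℕ) : s (n + 1) = s n ⊓ a (p (s n)) := rfl
  have hs_anti : Antitone s := antitone_nat_of_succ_le fun n => hs_succ n ▸ inf_le_left
  have hs_le (n : ℕ) : s n ≤ b := hs_anti n.zero_le
  have hs_ne (n : ℕ) : s n ≠ ⊥ := by
    induction n with
    | zero => exact hb
    | succ n ih => exact (hp (s n) (hs_le n) ih).1
  refine ⟨fun n => p (s n), fun hle => ?_⟩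
  set x : ℕ → I := fun n => p (s n)
  -- Below `s (g x)` every `a (x m)` with `m < g x` holds, so only the infinite meet survives in
  -- each term.
  have key : s (g x) ≤ ⨅ n, a (x n) := by
    rw [← inf_eq_left.2 ((hs_le (g x)).trans hle), inf_iSup_eq]
    refine iSup_le fun m => ?_
    rw [inf_iSup_eq]
    refine iSup_le fun hm => ?_
    have hsm : s (g x) ≤ a (x m) :=
      (hs_anti (Nat.succ_le_of_lt hm)).trans (hs_succ m ▸ inf_le_right)
    rw [inf_sup_left, inf_compl_eq_bot_iff_le.2 hsm, bot_sup_eq]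
    exact inf_le_right
  -- The index `x (g x)` was chosen undecided by `s (g x)`, yet `key` decides it.
  exact (hp _ (hs_le (g x)) (hs_ne (g x))).2 (inf_compl_eq_bot_iff_le.2 (key.trans (iInf_le _ _)))

/-- Weak distributivity for partitions of unity indexed by sequences in `I` implies that every
family `a : I → B` is decided on a dense set. -/
theorem iSup_iInf_decide_eq_top {B : Type*} [CompleteBooleanAlgebra B] {I : Type*}
    (hweak : ∀ w : (ℕ → I) → ℕ → B, (∀ x, ⨆ n, w x n = ⊤) →
      ⨆ g : (ℕ → I) → ℕ, ⨅ x, ⨆ m, ⨆ _ : m < g x, w x m = ⊤) (a : I → B) :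
    (⨆ h : I → Bool, ⨅ i, bif h i then a i else (a i)ᶜ) = ⊤ := by
  set R := ⨆ h : I → Bool, ⨅ i, bif h i then a i else (a i)ᶜ
  by_contra hne
  have hcover : ∀ x : ℕ → I, ⨆ n, ((a (x n))ᶜ ⊔ ⨅ m, a (x m)) = ⊤ := fun x => by
    rw [← iSup_sup, ← compl_iInf, compl_sup_eq_top]
  obtain ⟨g, hg⟩ : ∃ g : (ℕ → I) → ℕ,
      Rᶜ ⊓ (⨅ x, ⨆ m, ⨆ _ : m < g x, (a (x m))ᶜ ⊔ ⨅ n, a (x n)) ≠ ⊥ := by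
    by_contra! hall
    have htop := hweak _ hcover
    have : Rᶜ ⊓ ⊤ = ⊥ := by
      rw [← htop, inf_iSup_eq]
      exact iSup_eq_bot.2 hall
    exact hne (compl_eq_bot.1 (by simpa using this))
  -- A nonzero `d` deciding every `a i` would lie below `R`, while here `d ≤ Rᶜ`.
  obtain ⟨x, hx⟩ := exists_seq_not_le a g hg fun d hd hd0 => by
    by_contra! hdec
    classical
    have hdR : d ≤ R := by
      refine le_trans (le_iInf fun i => ?_)
        (le_iSup (fun h : I → Bool => ⨅ i, bif h i then a i else (a i)ᶜ) fun i => decide (d ≤ a i))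
      by_cases h : d ≤ a i
      · simp [h]
      · have hbot : d ⊓ a i = ⊥ := by
          by_contra h'
          exact h (inf_compl_eq_bot_iff_le.1 (hdec i h'))
        simpa [h] using le_compl_iff_disjoint_right.2 (disjoint_iff.2 hbot)
    exact hd0 (le_bot_iff.1 ((le_inf hdR (hd.trans inf_le_left)).trans_eq inf_compl_eq_bot))
  exact hx (inf_le_right.trans (iInf_le _ x))

/-- Weak `(l, ω)`-distributivity transferred along `Set.Iio l ≃ X`. -/
theorem IsWeaklyDistributiveBA.iSup_iInf_eq_top {B : Type u} [CompleteBooleanAlgebra B]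
    {l : Ordinal.{v}} (hB : IsWeaklyDistributiveBA B l ω) {X : Type*} (e : Set.Iio l ≃ X)
    (w : X → ℕ → B) (hw : ∀ x, ⨆ n, w x n = ⊤) :
    ⨆ g : X → ℕ, ⨅ x, ⨆ m, ⨆ _ : m < g x, w x m = ⊤ := by
  have hex (b : Set.Iio (ω : Ordinal.{v})) : ∃ n : ℕ, (b : Ordinal) = n := Ordinal.lt_omega0.1 b.2
  choose q hq using hex
  have hqn (n : ℕ) : q ⟨n, Ordinal.natCast_lt_omega0 n⟩ = n :=
    Nat.cast_injective (R := Ordinal) (hq _).symm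
  have hlt {b b' : Set.Iio (ω : Ordinal.{v})} (h : b < b') : q b < q b' := by
    have h' : (b : Ordinal) < b' := h
    rw [hq, hq] at h'
    exact_mod_cast h'
  have hu := hB fun a b => w (e a) (q b)
  have hl : (⨅ a, ⨆ b, w (e a) (q b)) = ⊤ := iInf_eq_top.2 fun a => by
    rw [eq_top_iff, ← hw (e a)]
    exact iSup_le fun n => le_iSup_of_le ⟨n, Ordinal.natCast_lt_omega0 n⟩ (by rw [hqn])
  rw [hl] at hu
  rw [eq_top_iff, hu]
  refine iSup_le fun g => le_iSup_of_le (fun x => q (g (e.symm x))) (le_iInf fun x => ?_)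
  refine (iInf_le _ (e.symm x)).trans (iSup₂_le fun b hb => ?_)
  rw [e.apply_symm_apply]
  exact le_iSup₂_of_le (q b) (hlt hb) le_rfl

theorem nonempty_equiv_Iio_ord_power_aleph0 (c : Cardinal.{v}) :
    Nonempty (Set.Iio (c ^ ℵ₀).ord ≃ (ℕ → Set.Iio c.ord)) := by
  rw [← Cardinal.eq]
  simp [Cardinal.mk_Iio_ordinal]

/-- `(l, 2)`-distributivity follows from the density of elements deciding a given `l`-sequence. -/
theorem isDistributiveBA_two {B : Type u} [CompleteBooleanAlgebra B] {l : Ordinal.{v}}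
    (hdec : ∀ a : Set.Iio l → B,
      (⨆ h : Set.Iio l → Bool, ⨅ i, bif h i then a i else (a i)ᶜ) = ⊤) :
    IsDistributiveBA B l 2 := by
  intro u
  have h2 : (1 : Ordinal.{v}) < 2 := one_lt_two
  let z : Set.Iio (2 : Ordinal.{v}) := ⟨0, zero_lt_one.trans h2⟩
  let o : Set.Iio (2 : Ordinal.{v}) := ⟨1, h2⟩
  have hzo (b : Set.Iio (2 : Ordinal.{v})) : b = z ∨ b = o := by
    have hb : (b : Ordinal) ≤ 1 := by
      rw [← Order.lt_add_one_iff, one_add_one_eq_two]; exact b.2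
    rcases Order.le_one_iff.1 hb with h | h
    exacts [.inl (Subtype.ext h), .inr (Subtype.ext h)]
  refine le_antisymm ?_ (iSup_le fun f => le_iInf fun a => (iInf_le _ a).trans (le_iSup (u a) _))
  -- Deciding `u i z` alone suffices: where it fails, `u i z ⊔ u i o` leaves `u i o`.
  rw [← inf_top_eq (⨅ a, ⨆ b, u a b), ← hdec fun i => u i z, inf_iSup_eq]
  refine iSup_le fun h => le_iSup_of_le (fun i => bif h i then z else o) (le_iInf fun i => ?_)
  have hi := inf_le_inf (iInf_le (fun a => ⨆ b, u a b) i)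
    (iInf_le (fun i => bif h i then u i z else (u i z)ᶜ) i)
  refine hi.trans ?_
  beta_reduce
  cases h i with
  | true => exact inf_le_right
  | false =>
    have hsup : ⨆ b, u i b ≤ u i z ⊔ u i o := iSup_le fun b => by
      rcases hzo b with rfl | rfl
      exacts [le_sup_left, le_sup_right]
    rw [cond_false, cond_false, ← sdiff_eq]
    exact sdiff_le_iff.2 hsup

theorem mainTheorem1 {B : Type u} [CompleteBooleanAlgebra B] (c : Cardinal.{v}) (hc : ℵ₀ ≤ c)
    (hB : IsWeaklyDistributiveBA B (c ^ ℵ₀).ord ω) :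
    IsDistributiveBA B c.ord 2 := by
  obtain ⟨e⟩ := nonempty_equiv_Iio_ord_power_aleph0 c
  exact isDistributiveBA_two (iSup_iInf_decide_eq_top (hB.iSup_iInf_eq_top e))
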